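/- Let $K$ be a field of characteristic zero, $n\in\mathbb{N}$, and $P_n=K[x_1,\dots,x_n]$. Let $\mathbb{I}_n=K\langle x_1,\dots,x_n,\frac{\partial}{\partial x_1},\dots,\frac{\partial}{\partial x_n},\int_1,\dots,\int_n\rangle$ be the algebra of polynomial integro-differential operators, i.e. the $K$-subalgebra of $\operatorname{End}_K(P_n)$ generated by the multiplications by the $x_i$, the partial derivatives $\frac{\partial}{\partial x_i}$, and the integrations $\int_i\colon x^\alpha\mapsto(\alpha_i+1)^{-1}x_ix^\alpha$ $(1\le i\le n,\ \alpha\in\mathbb{N}^n)$. A two-sided ideal $\mathfrak{p}\neq\mathbb{I}_n$ is called prime if, for all two-sided ideals $\mathfrak{a},\mathfrak{b}$ of $\mathbb{I}_n$, $\mathfrak{a}\mathfrak{b}\subseteq\mathfrak{p}$ implies $\mathfrak{a}\subseteq\mathfrak{p}$ or $\mathfrak{b}\subseteq\mathfrak{p}$. **Theorem.** No proper prime factor algebra of $\mathbb{I}_n$ can be embedded into $\mathbb{I}_n$; that is, for each nonzero prime ideal $\mathfrak{p}$ of $\mathbb{I}_n$, there is no injective (unital) $K$-algebra homomorphism $\mathbb{I}_n/\mathfrak{p}\to\mathbb{I}_n$.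 -/

import Mathlib

namespace IntDiff

open MvPolynomial

/-- Integration with respect to `x_i`: the `K`-linear endomorphism of `K[x_1, …, x_n]` with
`x^α ↦ (α_i + 1)⁻¹ x_i x^α`. -/
noncomputable def integral (K : Type*) [Field K] (n : ℕ) (i : Fin n) :
    Module.End K (MvPolynomial (Fin n) K) :=
  (basisMonomials (Fin n) K).constr K fun α =>
    monomial (α + Finsupp.single i 1) (((α i : K) + 1)⁻¹)

theorem integral_monomial (K : Type*) [Field K] (n : ℕ) (i : Fin n) (α : Fin n →₀ ℕ) (c : K) :
    integral K n i (monomial α c) =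
      monomial (α + Finsupp.single i 1) (c * ((α i : K) + 1)⁻¹) := by
  have h : monomial α c = c • basisMonomials (Fin n) K α := by
    simp [smul_monomial]
  rw [h, map_smul, integral, Module.Basis.constr_basis, smul_monomial, smul_eq_mul]

/-- The algebra `𝕀_n = K⟨x_1, …, x_n, ∂/∂x_1, …, ∂/∂x_n, ∫_1, …, ∫_n⟩` of polynomial
integro-differential operators, a subalgebra of `End_K(K[x_1, …, x_n])`. -/
noncomputable def integroDiffAlgebra (K : Type*) [Field K] (n : ℕ) :
    Subalgebra K (Module.End K (MvPolynomial (Fin n) K)) :=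
  Algebra.adjoin K
    (Set.range (fun i : Fin n => LinearMap.mulLeft K (X i : MvPolynomial (Fin n) K)) ∪
      Set.range (fun i : Fin n =>
        ((pderiv i : Derivation K (MvPolynomial (Fin n) K) (MvPolynomial (Fin n) K)) :
          MvPolynomial (Fin n) K →ₗ[K] MvPolynomial (Fin n) K)) ∪
      Set.range (integral K n))

/-- A two-sided ideal `p` of a (not necessarily commutative) ring is prime if it is proper and, for
all two-sided ideals `I` and `J`, `IJ ⊆ p` (that is, `ab ∈ p` for all `a ∈ I` and `b ∈ J`) implies
`I ⊆ p` or `J ⊆ p`. -/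
structure IsPrimeTwoSided {R : Type*} [Ring R] (p : TwoSidedIdeal R) : Prop where
  ne_top : p ≠ ⊤
  le_or_le : ∀ I J : TwoSidedIdeal R, (∀ a ∈ I, ∀ b ∈ J, a * b ∈ p) → I ≤ p ∨ J ≤ p

end IntDiff

/-! A nonzero ideal contains the projection of `K[x]` onto the constants, which is the product of
the commuting idempotents `e_i = 1 - ∫_i ∂_i`. A nonzero prime therefore contains some `e_i`
(`IsPrimeTwoSided.exists_evalZero_mem`). A homomorphism from the quotient to `𝕀_n` would then send
`∂_i` to a unit `u` with inverse the image of `∫_i`, and `h`, the image of `∂_i x_i`, would satisfy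
`u h = (h + 1) u`. `IsRegular.not_conj_eq_add_one` excludes this.

For the exclusion, operators are written as matrices in the basis `x^α / α!`. Elements of `𝕀_n` have
finitely many nonzero diagonals, each given by a polynomial once all coordinates are large
(`isRegular_of_mem`). Up to eventual vanishing, diagonals multiply as in a `ℤ^n`-graded domain, so a
unit lives on a single diagonal `β` (`exists_diagVanishes_of_mul_eq_one`). If `β = 0`, the diagonals
of `u` and `h` commute, which forces `u` to vanish far out (`false_of_diagonal`). If `β ≠ 0`, then
`u` or its inverse is an injective map that lowers some exponent far out, and a dimension count
rules this out (`false_of_injective`). -/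

namespace IntDiff

open MvPolynomial Filter
open scoped Nat

/-! ### Divided powers indexed by `ℤ^n`, and the generators in this basis -/

section DividedPowers

variable (K : Type*) [Field K] {n : ℕ}

/-- `1 / t!`, with the value `0` at negative integers. -/
noncomputable def invFact (t : ℤ) : K := if 0 ≤ t then ((t.toNat ! : ℕ) : K)⁻¹ else 0

/-- At `t = -1` the factor `t + 1` vanishes, so the factorial recursion has no boundary exception.
This is what makes integer exponents convenient. -/
theorem invFact_succ [CharZero K] (t : ℤ) : ((t : K) + 1) * invFact K (t + 1) = invFact K t := by
  unfold invFact
  rcases lt_trichotomy t (-1) with h | h | h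
  · rw [if_neg (by lia), if_neg (by lia), mul_zero]
  · subst h
    simp
  · obtain ⟨m, rfl⟩ : ∃ m : ℕ, t = m := ⟨t.toNat, by lia⟩
    have h1 : ((m : ℤ) + 1).toNat = m + 1 := by lia
    have h2 : (m : K) + 1 ≠ 0 := by exact_mod_cast m.succ_ne_zero
    rw [if_pos (by lia), if_pos (by lia), h1, Int.toNat_natCast, Nat.factorial_succ]
    push_cast
    rw [mul_inv, mul_inv_cancel_left₀ h2]

/-- The exponent with nonnegative parts of the coordinates of `α`. -/
noncomputable def expo (α : Fin n → ℤ) : Fin n →₀ ℕ :=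
  Finsupp.equivFunOnFinite.symm fun i => (α i).toNat

@[simp] theorem expo_apply (α : Fin n → ℤ) (i : Fin n) : expo α i = (α i).toNat := rfl

/-- The divided power `x^α / α!`, with the value `0` if some `α i` is negative. -/
noncomputable def dpow (α : Fin n → ℤ) : MvPolynomial (Fin n) K :=
  monomial (expo α) (∏ i, invFact K (α i))

open Classical in
/-- The coefficient of `dpow K γ`. -/
noncomputable def dcoeff (γ : Fin n → ℤ) : MvPolynomial (Fin n) K →ₗ[K] K :=
  if 0 ≤ γ then (∏ i, (((γ i).toNat ! : ℕ) : K)) • lcoeff K (expo γ) else 0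

theorem prod_invFact_of_neg {α : Fin n → ℤ} (i : Fin n) (h : α i < 0) :
    ∏ j, invFact K (α j) = 0 :=
  Finset.prod_eq_zero (Finset.mem_univ i) (by simp [invFact, h])

theorem dpow_of_neg {α : Fin n → ℤ} (i : Fin n) (h : α i < 0) : dpow K α = 0 := by
  rw [dpow, prod_invFact_of_neg K i h, map_zero]

theorem dpow_of_not_nonneg {α : Fin n → ℤ} (h : ¬ 0 ≤ α) : dpow K α = 0 := by
  rw [Pi.le_def] at h
  push Not at h
  obtain ⟨i, hi⟩ := h
  exact dpow_of_neg K i hi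

theorem dcoeff_of_not_nonneg {γ : Fin n → ℤ} (h : ¬ 0 ≤ γ) : dcoeff K γ = 0 := if_neg h

theorem dcoeff_apply {γ : Fin n → ℤ} (h : 0 ≤ γ) (f : MvPolynomial (Fin n) K) :
    dcoeff K γ f = (∏ i, (((γ i).toNat ! : ℕ) : K)) * coeff (expo γ) f := by
  rw [dcoeff, if_pos h]
  rfl

theorem expo_injOn {α γ : Fin n → ℤ} (hα : 0 ≤ α) (hγ : 0 ≤ γ) (h : expo α = expo γ) :
    α = γ := by
  ext i
  have h1 := DFunLike.congr_fun h i
  have h2 := hα i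
  have h3 := hγ i
  simp only [expo_apply, Pi.zero_apply] at h1 h2 h3
  lia

theorem prod_factorial_mul_prod_invFact [CharZero K] {α : Fin n → ℤ} (hα : 0 ≤ α) :
    (∏ i, (((α i).toNat ! : ℕ) : K)) * ∏ i, invFact K (α i) = 1 := by
  rw [← Finset.prod_mul_distrib]
  refine Finset.prod_eq_one fun i _ => ?_
  rw [invFact, if_pos (show 0 ≤ α i from hα i), mul_inv_cancel₀]
  exact_mod_cast Nat.factorial_ne_zero _

theorem dcoeff_dpow_self [CharZero K] {α : Fin n → ℤ} (hα : 0 ≤ α) :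
    dcoeff K α (dpow K α) = 1 := by
  rw [dcoeff_apply K hα, dpow, coeff_monomial, if_pos rfl, prod_factorial_mul_prod_invFact K hα]

theorem dcoeff_dpow_of_ne {α γ : Fin n → ℤ} (h : γ ≠ α) : dcoeff K γ (dpow K α) = 0 := by
  by_cases hα : 0 ≤ α
  · by_cases hγ : 0 ≤ γ
    · rw [dcoeff_apply K hγ, dpow, coeff_monomial, if_neg, mul_zero]
      exact fun h' => h (expo_injOn hγ hα h'.symm)
    · rw [dcoeff_of_not_nonneg K hγ, LinearMap.zero_apply]
  · rw [dpow_of_not_nonneg K hα, map_zero]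

theorem dcoeff_mul_dcoeff_dpow [CharZero K] (γ δ : Fin n → ℤ) (f : MvPolynomial (Fin n) K) :
    dcoeff K δ f * dcoeff K γ (dpow K δ) = if γ = δ then dcoeff K δ f else 0 := by
  split_ifs with h
  · subst h
    by_cases h0 : 0 ≤ γ
    · rw [dcoeff_dpow_self K h0, mul_one]
    · rw [dcoeff_of_not_nonneg K h0, LinearMap.zero_apply, zero_mul]
  · rw [dcoeff_dpow_of_ne K h, mul_zero]

theorem expo_natCast (ν : Fin n →₀ ℕ) : expo (fun i => (ν i : ℤ)) = ν := by
  ext i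
  simp

theorem dcoeff_ext [CharZero K] {f g : MvPolynomial (Fin n) K}
    (h : ∀ γ, dcoeff K γ f = dcoeff K γ g) : f = g := by
  ext ν
  have h0 : (0 : Fin n → ℤ) ≤ fun i => (ν i : ℤ) := fun i => by simp
  have h1 := h fun i => (ν i : ℤ)
  rw [dcoeff_apply K h0, dcoeff_apply K h0, expo_natCast] at h1
  refine mul_left_cancel₀ ?_ h1
  exact Finset.prod_ne_zero_iff.2 fun i _ => by exact_mod_cast Nat.factorial_ne_zero _

theorem eq_sum_dcoeff_smul_dpow [CharZero K] (f : MvPolynomial (Fin n) K)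
    (S : Finset (Fin n → ℤ)) (hS : ∀ γ, dcoeff K γ f ≠ 0 → γ ∈ S) :
    f = ∑ γ ∈ S, dcoeff K γ f • dpow K γ := by
  refine dcoeff_ext K fun γ => ?_
  simp only [map_sum, map_smul, smul_eq_mul, dcoeff_mul_dcoeff_dpow, Finset.sum_ite_eq]
  split_ifs with h
  · rfl
  · by_contra h'
    exact h (hS γ h')

theorem linearMap_ext_dpow [CharZero K] {N : Type*} [AddCommGroup N] [Module K N]
    {a b : MvPolynomial (Fin n) K →ₗ[K] N} (h : ∀ α, 0 ≤ α → a (dpow K α) = b (dpow K α)) : a = b := by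
  refine (basisMonomials (Fin n) K).ext fun ν => ?_
  have h0 : (0 : Fin n → ℤ) ≤ fun i => (ν i : ℤ) := fun i => by simp
  have h1 : basisMonomials (Fin n) K ν =
      (∏ i, (((ν i : ℤ).toNat ! : ℕ) : K)) • dpow K fun i => (ν i : ℤ) := by
    rw [dpow, smul_monomial, expo_natCast, smul_eq_mul, prod_factorial_mul_prod_invFact K h0,
      coe_basisMonomials]
  rw [h1, map_smul, map_smul, h _ h0]

theorem linearIndepOn_dpow [CharZero K] (S : Set (Fin n → ℤ)) (hS : ∀ α ∈ S, 0 ≤ α) :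
    LinearIndepOn K (dpow K) S := by
  rw [linearIndepOn_iff']
  intro t g ht h i hi
  have := congrArg (dcoeff K i) h
  simp only [map_sum, map_smul, smul_eq_mul, map_zero] at this
  rwa [Finset.sum_eq_single i (fun j _ hj => by rw [dcoeff_dpow_of_ne K hj.symm, mul_zero])
    (fun h => (h hi).elim), dcoeff_dpow_self K (hS i (ht hi)), mul_one] at this

theorem succ_mul_prod_invFact [CharZero K] (α : Fin n → ℤ) (i : Fin n) :
    ((α i : K) + 1) * ∏ j, invFact K ((α + Pi.single i 1 : Fin n → ℤ) j) = ∏ j, invFact K (α j) := by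
  rw [← Finset.mul_prod_erase _ _ (Finset.mem_univ i),
    ← Finset.mul_prod_erase _ (fun j => invFact K (α j)) (Finset.mem_univ i), ← mul_assoc]
  simp only [Pi.add_apply, Pi.single_eq_same, invFact_succ]
  congr 1
  refine Finset.prod_congr rfl fun j hj => ?_
  rw [Pi.single_eq_of_ne (Finset.ne_of_mem_erase hj), add_zero]

theorem expo_add_single {α : Fin n → ℤ} (i : Fin n) (h : 0 ≤ α i) :
    expo (α + Pi.single i 1) = expo α + Finsupp.single i 1 := by
  ext j
  by_cases hj : j = i
  · subst hj
    simp
    lia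
  · simp [hj]

theorem expo_sub_single (α : Fin n → ℤ) (i : Fin n) :
    expo (α + Pi.single i (-1)) = expo α - Finsupp.single i 1 := by
  ext j
  by_cases hj : j = i
  · subst hj
    simp
    lia
  · simp [hj]

theorem X_mul_dpow [CharZero K] (i : Fin n) (α : Fin n → ℤ) :
    LinearMap.mulLeft K (X i : MvPolynomial (Fin n) K) (dpow K α) =
      ((α i : K) + 1) • dpow K (α + Pi.single i 1) := by
  rw [LinearMap.mulLeft_apply]
  by_cases h : 0 ≤ α i
  · rw [dpow, dpow, smul_monomial, smul_eq_mul, succ_mul_prod_invFact, expo_add_single i h, X,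
      monomial_mul, one_mul, add_comm]
  · rw [dpow_of_neg K i (by lia), mul_zero]
    rw [dpow, smul_monomial, smul_eq_mul, succ_mul_prod_invFact, prod_invFact_of_neg K i (by lia),
      map_zero]

theorem pderiv_dpow [CharZero K] (i : Fin n) (α : Fin n → ℤ) :
    pderiv i (dpow K α) = dpow K (α + Pi.single i (-1)) := by
  rw [dpow, dpow, pderiv_monomial, expo_sub_single]
  congr 1
  have h := succ_mul_prod_invFact K (α + Pi.single i (-1)) i
  have h1 : α + Pi.single i (-1) + Pi.single i 1 = α := by
    rw [add_assoc, ← Pi.single_add]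
    simp
  rw [h1] at h
  rw [← h, mul_comm]
  by_cases hi : 0 ≤ α i
  · congr 1
    simp only [expo_apply, Pi.add_apply, Pi.single_eq_same]
    obtain ⟨m, hm⟩ : ∃ m : ℕ, α i = m := ⟨(α i).toNat, by lia⟩
    simp [hm]
  · rw [prod_invFact_of_neg K i (by lia), mul_zero, mul_zero]

/-- The coefficient must vanish at `α i = -1`: the source is zero there while the shifted divided
power need not be. -/
theorem integral_dpow [CharZero K] (i : Fin n) (α : Fin n → ℤ) :
    integral K n i (dpow K α) =
      (if α i = -1 then 0 else 1 : K) • dpow K (α + Pi.single i 1) := by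
  by_cases h : 0 ≤ α i
  · rw [if_neg (by lia), one_smul, dpow, integral_monomial, dpow, expo_add_single i h]
    congr 1
    rw [← succ_mul_prod_invFact K α i, expo_apply]
    obtain ⟨m, hm⟩ : ∃ m : ℕ, α i = m := ⟨(α i).toNat, by lia⟩
    have h2 : (m : K) + 1 ≠ 0 := by exact_mod_cast m.succ_ne_zero
    rw [hm]
    simp only [Int.toNat_natCast, Int.cast_natCast]
    field_simp
  · rw [dpow_of_neg K i (by lia), map_zero]
    split_ifs with h'
    · rw [zero_smul]
    · rw [dpow_of_neg K i (by simp; lia), smul_zero]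

end DividedPowers

/-! ### Functions that are polynomial far from the coordinate walls -/

section EventuallyPolynomial

variable {K : Type*} [Field K] {n : ℕ}

/-- `f` agrees with a polynomial function at all sufficiently large points. -/
def EventuallyPoly (f : (Fin n → ℤ) → K) : Prop :=
  ∃ P : MvPolynomial (Fin n) K, ∀ᶠ α in atTop, f α = eval (fun i => (α i : K)) P

theorem tendsto_add_atTop (δ : Fin n → ℤ) : Tendsto (fun α => α + δ) atTop atTop :=
  tendsto_atTop_add_const_right _ _ tendsto_id

theorem EventuallyPoly.congr {f g : (Fin n → ℤ) → K} (hf : EventuallyPoly f)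
    (h : ∀ᶠ α in atTop, g α = f α) : EventuallyPoly g := by
  obtain ⟨P, hP⟩ := hf
  refine ⟨P, ?_⟩
  filter_upwards [hP, h] with α h1 h2
  rw [h2, h1]

theorem EventuallyPoly.zero : EventuallyPoly (fun _ : Fin n → ℤ => (0 : K)) :=
  ⟨0, by simp⟩

theorem EventuallyPoly.add {f g : (Fin n → ℤ) → K} (hf : EventuallyPoly f)
    (hg : EventuallyPoly g) : EventuallyPoly fun α => f α + g α := by
  obtain ⟨P, hP⟩ := hf
  obtain ⟨Q, hQ⟩ := hg
  refine ⟨P + Q, ?_⟩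
  filter_upwards [hP, hQ] with α h1 h2
  rw [h1, h2, map_add]

theorem EventuallyPoly.mul {f g : (Fin n → ℤ) → K} (hf : EventuallyPoly f)
    (hg : EventuallyPoly g) : EventuallyPoly fun α => f α * g α := by
  obtain ⟨P, hP⟩ := hf
  obtain ⟨Q, hQ⟩ := hg
  refine ⟨P * Q, ?_⟩
  filter_upwards [hP, hQ] with α h1 h2
  rw [h1, h2, map_mul]

theorem EventuallyPoly.sum {ι : Type*} (s : Finset ι) {f : ι → (Fin n → ℤ) → K}
    (hf : ∀ i ∈ s, EventuallyPoly (f i)) : EventuallyPoly fun α => ∑ i ∈ s, f i α := by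
  classical
  induction s using Finset.induction_on with
  | empty => simpa using EventuallyPoly.zero
  | insert i s hi ih =>
    simp only [Finset.sum_insert hi]
    exact (hf i (Finset.mem_insert_self i s)).add
      (ih fun j hj => hf j (Finset.mem_insert_of_mem hj))

theorem EventuallyPoly.shift {f : (Fin n → ℤ) → K} (hf : EventuallyPoly f) (δ : Fin n → ℤ) :
    EventuallyPoly fun α => f (α + δ) := by
  obtain ⟨P, hP⟩ := hf
  refine ⟨aeval (fun i => X i + C ((δ i : ℤ) : K)) P, ?_⟩
  filter_upwards [(tendsto_add_atTop δ).eventually hP] with α h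
  rw [h, ← coe_aeval_eq_eval, RingHom.coe_coe, ← coe_aeval_eq_eval, RingHom.coe_coe,
    ← AlgHom.comp_apply, comp_aeval]
  simp

/-- The large integer points contain a product of infinite subsets of `K`, on which a nonzero
polynomial cannot vanish. -/
theorem eq_zero_of_eventually_eval_eq_zero [CharZero K] {P : MvPolynomial (Fin n) K}
    (h : ∀ᶠ α : Fin n → ℤ in atTop, eval (fun i => (α i : K)) P = 0) : P = 0 := by
  obtain ⟨α₀, h⟩ := eventually_atTop.1 h
  refine funext_set (fun i => (fun t : ℤ => (t : K)) '' Set.Ici (α₀ i))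
    (fun i => (Set.Ici_infinite _).image Int.cast_injective.injOn) fun x hx => ?_
  choose t ht htx using fun i => hx i (Set.mem_univ i)
  have := h t ht
  simp only [htx] at this
  rw [map_zero, this]

theorem EventuallyPoly.eventually_zero_or [CharZero K] {f g : (Fin n → ℤ) → K}
    (hf : EventuallyPoly f) (hg : EventuallyPoly g) (h : ∀ᶠ α in atTop, f α * g α = 0) :
    (∀ᶠ α in atTop, f α = 0) ∨ ∀ᶠ α in atTop, g α = 0 := by
  obtain ⟨P, hP⟩ := hf
  obtain ⟨Q, hQ⟩ := hg
  have h1 : P * Q = 0 := by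
    apply eq_zero_of_eventually_eval_eq_zero
    filter_upwards [hP, hQ, h] with α h1 h2 h3
    rw [map_mul, ← h1, ← h2, h3]
  refine (mul_eq_zero.1 h1).imp ?_ ?_
  · rintro rfl
    simpa using hP
  · rintro rfl
    simpa using hQ

end EventuallyPolynomial

/-! ### Regular operators and their diagonals at infinity -/

section Entries

variable {K : Type*} [Field K] {n : ℕ}

/-- The matrix entries of an endomorphism in the basis of divided powers. -/
noncomputable def entry (a : Module.End K (MvPolynomial (Fin n) K)) (γ α : Fin n → ℤ) : K :=
  dcoeff K γ (a (dpow K α))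

/-- `a` moves exponents by at most `d`. -/
def IsLocalWith (a : Module.End K (MvPolynomial (Fin n) K)) (d : Fin n → ℤ) : Prop :=
  ∀ α γ, entry a γ α ≠ 0 → γ - α ∈ Finset.Icc (-d) d

theorem IsLocalWith.mono {a : Module.End K (MvPolynomial (Fin n) K)} {d d' : Fin n → ℤ}
    (h : IsLocalWith a d) (hd : d ≤ d') : IsLocalWith a d' := fun α γ h' =>
  Finset.Icc_subset_Icc (neg_le_neg hd) hd (h α γ h')

/-- Endomorphisms with bounded displacement whose entries along each diagonal are eventually
polynomial. -/
structure IsRegular (a : Module.End K (MvPolynomial (Fin n) K)) : Prop where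
  exists_isLocalWith : ∃ d, IsLocalWith a d
  eventuallyPoly : ∀ β, EventuallyPoly fun α => entry a (α + β) α

theorem IsRegular.add {a b : Module.End K (MvPolynomial (Fin n) K)} (ha : IsRegular a)
    (hb : IsRegular b) : IsRegular (a + b) := by
  have h (γ α) : entry (a + b) γ α = entry a γ α + entry b γ α := by
    simp [entry]
  obtain ⟨d, hd⟩ := ha.exists_isLocalWith
  obtain ⟨d', hd'⟩ := hb.exists_isLocalWith
  refine ⟨⟨d ⊔ d', fun α γ h0 => ?_⟩, fun β => ?_⟩
  · rw [h] at h0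
    by_cases h1 : entry a γ α = 0
    · rw [h1, zero_add] at h0
      exact hd'.mono le_sup_right α γ h0
    · exact hd.mono le_sup_left α γ h1
  · simp only [h]
    exact (ha.eventuallyPoly β).add (hb.eventuallyPoly β)

/-- The entries of `a` on the diagonal `β` vanish at all sufficiently large points. -/
def DiagVanishes (a : Module.End K (MvPolynomial (Fin n) K)) (β : Fin n → ℤ) : Prop :=
  ∀ᶠ α in atTop, entry a (α + β) α = 0

theorem IsLocalWith.diagVanishes {a : Module.End K (MvPolynomial (Fin n) K)} {d β : Fin n → ℤ}
    (h : IsLocalWith a d) (hβ : β ∉ Finset.Icc (-d) d) : DiagVanishes a β :=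
  Eventually.of_forall fun α => by
    by_contra h'
    exact hβ (by simpa using h _ _ h')

theorem DiagVanishes.shift {a : Module.End K (MvPolynomial (Fin n) K)} {β δ : Fin n → ℤ}
    (h : DiagVanishes a (β - δ)) : ∀ᶠ α in atTop, entry a (α + β) (α + δ) = 0 := by
  filter_upwards [(tendsto_add_atTop δ).eventually h] with α hα
  simpa only [add_assoc, add_sub_cancel] using hα

theorem entry_one_of_ne {β : Fin n → ℤ} (hβ : β ≠ 0) (α : Fin n → ℤ) :
    entry (1 : Module.End K (MvPolynomial (Fin n) K)) (α + β) α = 0 :=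
  dcoeff_dpow_of_ne K (by simpa using hβ)

theorem injective_of_mul_eq_one {u v : Module.End K (MvPolynomial (Fin n) K)}
    (h : u * v = 1) : Function.Injective v := fun x y hxy => by
  have := congrArg u hxy
  rwa [← Module.End.mul_apply, ← Module.End.mul_apply, h] at this

variable [CharZero K]

theorem apply_dpow_eq_sum {a : Module.End K (MvPolynomial (Fin n) K)} {d : Fin n → ℤ}
    (h : IsLocalWith a d) (α : Fin n → ℤ) :
    a (dpow K α) = ∑ δ ∈ Finset.Icc (-d) d, entry a (α + δ) α • dpow K (α + δ) := by
  have := eq_sum_dcoeff_smul_dpow K (a (dpow K α))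
    ((Finset.Icc (-d) d).map (addLeftEmbedding α)) fun γ hγ =>
      Finset.mem_map.2 ⟨γ - α, h α γ hγ, by simp⟩
  rwa [Finset.sum_map] at this

theorem entry_mul (a : Module.End K (MvPolynomial (Fin n) K))
    {b : Module.End K (MvPolynomial (Fin n) K)} {d : Fin n → ℤ}
    (h : IsLocalWith b d) (γ α : Fin n → ℤ) :
    entry (a * b) γ α = ∑ δ ∈ Finset.Icc (-d) d, entry a γ (α + δ) * entry b (α + δ) α := by
  rw [entry, Module.End.mul_apply, apply_dpow_eq_sum h, map_sum, map_sum]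
  refine Finset.sum_congr rfl fun δ _ => ?_
  rw [map_smul, map_smul, smul_eq_mul, mul_comm]
  rfl

theorem IsLocalWith.mul {a b : Module.End K (MvPolynomial (Fin n) K)} {d d' : Fin n → ℤ}
    (ha : IsLocalWith a d) (hb : IsLocalWith b d') : IsLocalWith (a * b) (d + d') := by
  intro α γ h
  rw [entry_mul a hb] at h
  obtain ⟨δ, hδ, h⟩ := Finset.exists_ne_zero_of_sum_ne_zero h
  have h1 := Finset.mem_Icc.1 (ha _ _ (left_ne_zero_of_mul h))
  have h2 := Finset.mem_Icc.1 hδ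
  have h3 : γ - α = (γ - (α + δ)) + δ := by abel
  rw [Finset.mem_Icc, h3, neg_add]
  exact ⟨add_le_add h1.1 h2.1, add_le_add h1.2 h2.2⟩

/-- A diagonal of the product is a finite sum of products of shifted diagonals, finite because `b`
has bounded displacement. -/
theorem IsRegular.mul {a b : Module.End K (MvPolynomial (Fin n) K)} (ha : IsRegular a)
    (hb : IsRegular b) : IsRegular (a * b) := by
  obtain ⟨d, hd⟩ := ha.exists_isLocalWith
  obtain ⟨d', hd'⟩ := hb.exists_isLocalWith
  refine ⟨⟨d + d', hd.mul hd'⟩, fun β => ?_⟩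
  simp only [entry_mul a hd']
  refine EventuallyPoly.sum _ fun δ _ => EventuallyPoly.mul ?_ (hb.eventuallyPoly δ)
  have := (ha.eventuallyPoly (β - δ)).shift δ
  simpa only [add_assoc, add_sub_cancel] using this

theorem IsRegular.of_apply_dpow {a : Module.End K (MvPolynomial (Fin n) K)} {β : Fin n → ℤ}
    {c : (Fin n → ℤ) → K} (hc : EventuallyPoly c)
    (h : ∀ α, a (dpow K α) = c α • dpow K (α + β)) : IsRegular a := by
  refine ⟨⟨β ⊔ -β, fun α γ h0 => ?_⟩, fun β' => ?_⟩
  · rw [entry, h, map_smul] at h0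
    have h1 : γ = α + β := by
      by_contra h'
      exact h0 (by rw [dcoeff_dpow_of_ne K h', smul_zero])
    rw [h1, add_sub_cancel_left, Finset.mem_Icc]
    exact ⟨neg_le.1 le_sup_right, le_sup_left⟩
  · simp only [entry, h, map_smul]
    by_cases hβ : β' = β
    · subst hβ
      refine hc.congr ?_
      -- Away from the walls the target exponent is nonnegative, so its divided power is nonzero and
      -- the entry is exactly `c α`.
      filter_upwards [eventually_ge_atTop (-β')] with α hα
      rw [dcoeff_dpow_self K (by simpa [add_comm] using add_le_add_left hα β'), smul_eq_mul,
        mul_one]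
    · refine EventuallyPoly.zero.congr (Eventually.of_forall fun α => ?_)
      rw [dcoeff_dpow_of_ne K (by simpa using hβ), smul_zero]

theorem isRegular_mulLeft_X (i : Fin n) :
    IsRegular (LinearMap.mulLeft K (X i : MvPolynomial (Fin n) K)) :=
  .of_apply_dpow ⟨X i + 1, by simp⟩ (X_mul_dpow K i)

theorem isRegular_pderiv (i : Fin n) :
    IsRegular ((pderiv i : Derivation K (MvPolynomial (Fin n) K) (MvPolynomial (Fin n) K)) :
      MvPolynomial (Fin n) K →ₗ[K] MvPolynomial (Fin n) K) :=
  .of_apply_dpow (c := fun _ => 1) ⟨1, by simp⟩ fun α => by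
    rw [one_smul]
    exact pderiv_dpow K i α

theorem isRegular_integral (i : Fin n) : IsRegular (integral K n i) := by
  refine .of_apply_dpow ⟨1, ?_⟩ (integral_dpow K i)
  filter_upwards [eventually_ge_atTop 0] with α hα
  have := hα i
  rw [if_neg, map_one]
  simp only [Pi.zero_apply] at this
  lia

theorem isRegular_of_mem {a : Module.End K (MvPolynomial (Fin n) K)}
    (ha : a ∈ integroDiffAlgebra K n) : IsRegular a := by
  induction ha using Algebra.adjoin_induction with
  | mem a ha =>
    obtain (⟨i, rfl⟩ | ⟨i, rfl⟩) | ⟨i, rfl⟩ := ha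
    · exact isRegular_mulLeft_X i
    · exact isRegular_pderiv i
    · exact isRegular_integral i
  | algebraMap r =>
    exact .of_apply_dpow (c := fun _ => r) (β := 0) ⟨C r, by simp⟩ fun α => by
      simp [Module.algebraMap_end_apply]
  | add a b _ _ ha hb => exact ha.add hb
  | mul a b _ _ ha hb => exact ha.mul hb

theorem entry_one_self {α : Fin n → ℤ} (hα : 0 ≤ α) :
    entry (1 : Module.End K (MvPolynomial (Fin n) K)) α α = 1 :=
  dcoeff_dpow_self K hα

/-- If `b₀` is the only diagonal of `v` that contributes to the diagonal `β` of `u * v`, then the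
latter is a product of diagonals. -/
theorem eventually_entry_mul {u v : Module.End K (MvPolynomial (Fin n) K)} (hv : IsRegular v)
    {β b₀ : Fin n → ℤ} (h : ∀ δ ≠ b₀, DiagVanishes u (β - δ) ∨ DiagVanishes v δ) :
    ∀ᶠ α in atTop, entry (u * v) (α + β) α = entry u (α + β) (α + b₀) * entry v (α + b₀) α := by
  obtain ⟨d, hd⟩ := hv.exists_isLocalWith
  have h1 : ∀ᶠ α in atTop, ∀ δ ∈ Finset.Icc (-d) d, δ ≠ b₀ →
      entry u (α + β) (α + δ) * entry v (α + δ) α = 0 := by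
    rw [Filter.eventually_all_finset]
    intro δ _
    by_cases hδ : δ = b₀
    · exact Eventually.of_forall fun α h' => (h' hδ).elim
    · obtain h | h := h δ hδ
      · filter_upwards [h.shift] with α hα _
        rw [hα, zero_mul]
      · filter_upwards [h] with α hα _
        rw [hα, mul_zero]
  filter_upwards [h1] with α hα
  rw [entry_mul u hd]
  refine Finset.sum_eq_single b₀ hα fun hb => ?_
  by_contra h'
  exact hb (by simpa using hd _ _ (right_ne_zero_of_mul h'))

/-- With a single contributing pair of diagonals there is no cancellation, and polynomials over a
field form a domain. -/
theorem diagVanishes_or_of_mul {u v : Module.End K (MvPolynomial (Fin n) K)} (hu : IsRegular u)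
    (hv : IsRegular v) {a b : Fin n → ℤ}
    (h : ∀ δ ≠ b, DiagVanishes u (a + b - δ) ∨ DiagVanishes v δ)
    (huv : DiagVanishes (u * v) (a + b)) : DiagVanishes u a ∨ DiagVanishes v b := by
  have h1 : EventuallyPoly fun α => entry u (α + (a + b)) (α + b) := by
    simpa only [add_assoc, add_comm b a] using (hu.eventuallyPoly a).shift b
  refine (h1.eventually_zero_or (hv.eventuallyPoly b) ?_).imp_left fun h2 => ?_
  · filter_upwards [eventually_entry_mul hv h, huv] with α h3 h4
    rw [← h3, h4]
  · have := (tendsto_add_atTop (-b)).eventually h2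
    filter_upwards [this] with α hα
    simpa [add_assoc, add_comm a b] using hα

/-- This is the argument that units of a `ℤ^n`-graded domain are homogeneous. `A` and `B` are the
supports of `u` and `v` at infinity. -/
theorem exists_diagVanishes_of_mul_eq_one {u v : Module.End K (MvPolynomial (Fin n) K)}
    (hu : IsRegular u) (hv : IsRegular v) (huv : u * v = 1) :
    ∃ β, (∀ β' ≠ β, DiagVanishes u β') ∧ ∀ β' ≠ -β, DiagVanishes v β' := by
  classical
  obtain ⟨d, hd⟩ := hu.exists_isLocalWith
  obtain ⟨d', hd'⟩ := hv.exists_isLocalWith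
  obtain ⟨A, hA⟩ : ∃ A : Finset (Fin n → ℤ), ∀ β, β ∈ A ↔ ¬ DiagVanishes u β :=
    ⟨(Finset.Icc (-d) d).filter fun β => ¬ DiagVanishes u β, fun β => by
      rw [Finset.mem_filter, and_iff_right_iff_imp]
      exact fun h => by_contra fun h' => h (hd.diagVanishes h')⟩
  obtain ⟨B, hB⟩ : ∃ B : Finset (Fin n → ℤ), ∀ β, β ∈ B ↔ ¬ DiagVanishes v β :=
    ⟨(Finset.Icc (-d') d').filter fun β => ¬ DiagVanishes v β, fun β => by
      rw [Finset.mem_filter, and_iff_right_iff_imp]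
      exact fun h => by_contra fun h' => h (hd'.diagVanishes h')⟩
  have key {a b : Fin n → ℤ} (ha : a ∈ A) (hb : b ∈ B) (hab : UniqueAdd A B a b) :
      a + b = 0 := by
    by_contra h0
    refine (diagVanishes_or_of_mul (a := a) (b := b) hu hv ?_ ?_).elim
      ((hA a).1 ha) ((hB b).1 hb)
    · intro δ hδ
      by_contra! h
      exact hδ (hab ((hA _).2 h.1) ((hB _).2 h.2) (by simp)).2
    · rw [huv]
      exact Eventually.of_forall (entry_one_of_ne h0)
  -- Otherwise `ℤ^n` provides two distinct pairs with uniquely represented sums. By `key` both sums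
  -- are `0`, contradicting uniqueness.
  have hcard : A.card * B.card ≤ 1 := by
    by_contra! h
    obtain ⟨p, hp, q, hq, hpq, h1, h2⟩ := TwoUniqueSums.uniqueAdd_of_one_lt_card h
    rw [Finset.mem_product] at hp hq
    have := h1 hq.1 hq.2 ((key hq.1 hq.2 h2).trans (key hp.1 hp.2 h1).symm)
    exact hpq (Prod.ext this.1.symm this.2.symm)
  -- An empty support would make the main diagonal of `u * v = 1` vanish far out.
  have hne : A.Nonempty ∧ B.Nonempty := by
    by_contra h
    have h1 : ∀ δ : Fin n → ℤ, DiagVanishes u (0 - δ) ∨ DiagVanishes v δ := by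
      intro δ
      by_contra! h'
      exact h ⟨⟨_, (hA _).2 h'.1⟩, ⟨_, (hB _).2 h'.2⟩⟩
    have h2 := eventually_entry_mul (β := 0) (b₀ := 0) hv fun δ _ => h1 δ
    have h3 : ∀ᶠ α : Fin n → ℤ in atTop, False := by
      have h5 : ∀ᶠ α in atTop, entry u (α + 0) (α + 0) * entry v (α + 0) α = 0 := by
        obtain h | h := h1 0
        · filter_upwards [h.shift] with α hα
          rw [hα, zero_mul]
        · filter_upwards [h] with α hα
          rw [hα, mul_zero]
      filter_upwards [h2, h5, eventually_ge_atTop 0] with α h2 h5 h0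
      rw [h5, huv, add_zero, entry_one_self h0] at h2
      exact one_ne_zero h2
    exact h3.exists.choose_spec
  obtain ⟨⟨a, ha⟩, ⟨b, hb⟩⟩ := hne
  have hA1 := Finset.card_pos.2 ⟨a, ha⟩
  have hB1 := Finset.card_pos.2 ⟨b, hb⟩
  have hA2 : A.card ≤ 1 := by nlinarith
  have hB2 : B.card ≤ 1 := by nlinarith
  have hA3 {x} (hx : x ∈ A) : x = a := Finset.card_le_one.1 hA2 x hx a ha
  have hB3 {x} (hx : x ∈ B) : x = b := Finset.card_le_one.1 hB2 x hx b hb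
  have hab : a + b = 0 := key ha hb fun x y hx hy _ => ⟨hA3 hx, hB3 hy⟩
  refine ⟨a, fun x hx => ?_, fun x hx => ?_⟩
  · by_contra h
    exact hx (hA3 ((hA x).2 h))
  · by_contra h
    exact hx ((hB3 ((hB x).2 h)).trans (neg_eq_of_add_eq_zero_right hab).symm)

/-- Far out, the diagonal entries of `u * h` and `h * u` are the same product of scalars, so the
relation forces that of `u` to be zero, while `v * u = 1` makes it invertible. -/
theorem false_of_diagonal {u v h : Module.End K (MvPolynomial (Fin n) K)} (hu : IsRegular u)
    (hh : IsRegular h) (hd : ∀ β ≠ 0, DiagVanishes u β) (hvu : v * u = 1)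
    (huh : u * h = h * u + u) : False := by
  have h1 := eventually_entry_mul (u := u) (β := 0) (b₀ := 0) hh fun δ hδ =>
    .inl (hd _ (by simpa using hδ))
  have h2 := eventually_entry_mul (u := h) (β := 0) (b₀ := 0) hu fun δ hδ => .inr (hd _ hδ)
  have h3 := eventually_entry_mul (u := v) (β := 0) (b₀ := 0) hu fun δ hδ => .inr (hd _ hδ)
  obtain ⟨α, h1, h2, h3, h0⟩ :=
    (h1.and (h2.and (h3.and (eventually_ge_atTop 0)))).exists
  simp only [add_zero] at h1 h2 h3
  have h4 : entry (u * h) α α = entry (h * u) α α + entry u α α := by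
    rw [huh]
    simp [entry]
  rw [h1, h2, mul_comm, left_eq_add] at h4
  rw [h4, mul_zero, hvu, entry_one_self h0] at h3
  exact one_ne_zero h3

theorem card_le_card_of_injective {w : Module.End K (MvPolynomial (Fin n) K)}
    (hw : Function.Injective w) {S T : Finset (Fin n → ℤ)} (hS : ∀ α ∈ S, 0 ≤ α)
    (h : ∀ α ∈ S, w (dpow K α) ∈ Submodule.span K (dpow K '' (T : Set (Fin n → ℤ)))) :
    S.card ≤ T.card := by
  classical
  have h1 := (linearIndepOn_dpow K (S : Set (Fin n → ℤ)) hS).map_injOn w hw.injOn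
  have h2 := linearIndependent_le_span' _ h1 (T.image (dpow K) : Set (MvPolynomial (Fin n) K))
    (by
      rintro _ ⟨α, rfl⟩
      rw [Finset.coe_image]
      exact h α α.2)
  simp only [Finset.coe_sort_coe, Cardinal.mk_coe_finset, Nat.cast_le,
    Fintype.card_coe] at h2
  exact h2.trans Finset.card_image_le

/-- Dividing by `(s + 1) ^ m` and letting `s → ∞` gives `N + 1 ≤ N`. -/
theorem not_forall_succ_mul_pow_le (N D m : ℕ)
    (h : ∀ s : ℕ, (N + 1) * (s + 1) ^ m ≤ N * (s + 1 + 2 * D) ^ m) : False := by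
  have h1 : Tendsto (fun s : ℕ => (N : ℝ) * (1 + (2 * D : ℝ) * (1 / ((s : ℝ) + 1))) ^ m) atTop
      (nhds (N * (1 + (2 * D : ℝ) * 0) ^ m)) :=
    (((tendsto_one_div_add_atTop_nhds_zero_nat.const_mul _).const_add 1).pow m).const_mul _
  have h2 : ∀ s : ℕ, (N : ℝ) + 1 ≤ N * (1 + (2 * D : ℝ) * (1 / ((s : ℝ) + 1))) ^ m := by
    intro s
    have hs : (0 : ℝ) < (s : ℝ) + 1 := by positivity
    have h3 : ((N : ℝ) + 1) * ((s : ℝ) + 1) ^ m ≤ N * ((s : ℝ) + 1 + 2 * D) ^ m := by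
      exact_mod_cast h s
    have h4 : (s : ℝ) + 1 + 2 * D = (1 + (2 * D : ℝ) * (1 / ((s : ℝ) + 1))) * (s + 1) := by
      field_simp
    rw [h4, mul_pow, ← mul_assoc] at h3
    exact le_of_mul_le_mul_right h3 (by positivity)
  have h5 := ge_of_tendsto' h1 h2
  simp at h5
  linarith

/-- A long box of exponents, thin in direction `i`, is mapped into the span of a box with one fewer
layer in that direction. The spread in the other directions is negligible as the box grows. -/
theorem false_of_injective {w : Module.End K (MvPolynomial (Fin n) K)}
    (hw : Function.Injective w) (hr : IsRegular w) {β : Fin n → ℤ} {i : Fin n} (hβ : β i < 0)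
    (hd : ∀ β' ≠ β, DiagVanishes w β') : False := by
  obtain ⟨d, hloc⟩ := hr.exists_isLocalWith
  obtain ⟨D, hD⟩ : ∃ D : ℕ, d ≤ fun _ => (D : ℤ) := by
    refine ⟨∑ j, (d j).toNat, fun j => ?_⟩
    have := Finset.single_le_sum (f := fun j => (d j).toNat) (fun _ _ => Nat.zero_le _)
      (Finset.mem_univ j)
    simp only at this ⊢
    lia
  replace hloc := hloc.mono hD
  have hev : ∀ᶠ α in atTop, ∀ δ ∈ Finset.Icc (-fun _ => (D : ℤ)) (fun _ : Fin n => (D : ℤ)),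
      δ ≠ β → entry w (α + δ) α = 0 := by
    rw [Filter.eventually_all_finset]
    intro δ _
    by_cases hδ : δ = β
    · exact Eventually.of_forall fun α h' => (h' hδ).elim
    · filter_upwards [hd δ hδ] with α hα _ using hα
  obtain ⟨α₀, hα₀⟩ := eventually_atTop.1 hev
  obtain ⟨L, hL⟩ : ∃ L : ℕ, α₀ ≤ fun _ => (L : ℤ) := by
    refine ⟨∑ j, (α₀ j).toNat, fun j => ?_⟩
    have := Finset.single_le_sum (f := fun j => (α₀ j).toNat) (fun _ _ => Nat.zero_le _)
      (Finset.mem_univ j)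
    simp only at this ⊢
    lia
  refine not_forall_succ_mul_pow_le (L + D) D (Finset.univ.erase i).card fun s => ?_
  -- The top layer `L + D` is not reached by the image: from `α i < L` an exponent rises by at most
  -- `D`, and from `α i ≥ L` only `β` acts, lowering it. Negative `i`-exponents give zero, so the
  -- bottom stays at `0`.
  let S : Finset (Fin n → ℤ) := Finset.Icc (fun j => if j = i then 0 else (L : ℤ))
    (fun j => if j = i then (L + D : ℤ) else L + s)
  let T : Finset (Fin n → ℤ) := Finset.Icc (fun j => if j = i then 0 else (L - D : ℤ))
    (fun j => if j = i then (L + D - 1 : ℤ) else L + s + D)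
  have hS : S.card = (L + D + 1) * (s + 1) ^ (Finset.univ.erase i).card := by
    rw [Pi.card_Icc, ← Finset.mul_prod_erase _ _ (Finset.mem_univ i)]
    congr 1
    · simp
      lia
    · refine Finset.prod_eq_pow_card fun j hj => ?_
      rw [if_neg (Finset.ne_of_mem_erase hj), if_neg (Finset.ne_of_mem_erase hj), Int.card_Icc]
      lia
  have hT : T.card = (L + D) * (s + 1 + 2 * D) ^ (Finset.univ.erase i).card := by
    rw [Pi.card_Icc, ← Finset.mul_prod_erase _ _ (Finset.mem_univ i)]
    congr 1
    · simp
      lia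
    · refine Finset.prod_eq_pow_card fun j hj => ?_
      rw [if_neg (Finset.ne_of_mem_erase hj), if_neg (Finset.ne_of_mem_erase hj), Int.card_Icc]
      lia
  rw [← hS, ← hT]
  have hSmem {α} (hα : α ∈ S) (j) : (if j = i then 0 else (L : ℤ)) ≤ α j ∧
      α j ≤ if j = i then (L + D : ℤ) else L + s :=
    ⟨(Finset.mem_Icc.1 hα).1 j, (Finset.mem_Icc.1 hα).2 j⟩
  refine card_le_card_of_injective hw (fun α hα j => ?_) fun α hα => ?_
  · have := (hSmem hα j).1
    simp only [Pi.zero_apply]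
    split_ifs at this <;> lia
  rw [apply_dpow_eq_sum hloc]
  refine Submodule.sum_mem _ fun δ hδ => ?_
  by_cases h0 : entry w (α + δ) α = 0
  · rw [h0, zero_smul]
    exact Submodule.zero_mem _
  by_cases hneg : (α + δ) i < 0
  · rw [dpow_of_neg K i hneg, smul_zero]
    exact Submodule.zero_mem _
  refine Submodule.smul_mem _ _ (Submodule.subset_span ⟨α + δ, ?_, rfl⟩)
  have hδ' (j) : -(D : ℤ) ≤ δ j ∧ δ j ≤ D :=
    ⟨(Finset.mem_Icc.1 hδ).1 j, (Finset.mem_Icc.1 hδ).2 j⟩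
  have hi : α i < L ∨ δ i < 0 := by
    by_contra! h
    refine h0 (hα₀ α (fun j => (hL j).trans ?_) δ hδ ?_)
    · have := (hSmem hα j).1
      split_ifs at this with hj
      · subst hj
        exact h.1
      · exact this
    · rintro rfl
      exact hβ.not_ge h.2
  refine Finset.mem_coe.2 (Finset.mem_Icc.2 ⟨fun j => ?_, fun j => ?_⟩)
  · have h1 := hSmem hα j
    have h2 := hδ' j
    rw [Pi.add_apply] at *
    split_ifs at * with hj
    · subst hj
      lia
    · lia
  · have h1 := hSmem hα j
    have h2 := hδ' j
    rw [Pi.add_apply] at *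
    split_ifs at * with hj
    · subst hj
      lia
    · lia

/-- No invertible regular `u` satisfies `u h = (h + 1) u` for a regular `h`. -/
theorem IsRegular.not_conj_eq_add_one {u v h : Module.End K (MvPolynomial (Fin n) K)}
    (hu : IsRegular u) (hv : IsRegular v) (hh : IsRegular h) (huv : u * v = 1) (hvu : v * u = 1)
    (huh : u * h = h * u + u) : False := by
  obtain ⟨β, h1, h2⟩ := exists_diagVanishes_of_mul_eq_one hu hv huv
  by_cases hβ : β = 0
  · subst hβ
    exact false_of_diagonal hu hh h1 hvu huh
  · obtain ⟨i, hi⟩ := Function.ne_iff.1 hβ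
    rcases lt_or_gt_of_ne hi with hi | hi
    · exact false_of_injective (injective_of_mul_eq_one hvu) hu hi h1
    -- The inverse `v` sits on the diagonal `-β`, so it is the one that lowers the exponent.
    · exact false_of_injective (injective_of_mul_eq_one huv) hv (i := i) (by simpa using hi) h2

end Entries

/-! ### Primes and products of elements from commuting subalgebras -/

section PrimeIdeals

theorem IsPrimeTwoSided.mem_or_mem {R : Type*} [Ring R] {p : TwoSidedIdeal R}
    (hp : IsPrimeTwoSided p) {a b : R} (h : ∀ r, a * r * b ∈ p) : a ∈ p ∨ b ∈ p := by
  have h1 : ∀ x ∈ TwoSidedIdeal.span {a}, ∀ r, x * r * b ∈ p := by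
    intro x hx
    induction hx using TwoSidedIdeal.span_induction with
    | mem x hx =>
      obtain rfl := hx
      exact h
    | zero => simp [p.zero_mem]
    | add x y _ _ hx hy =>
      intro r
      rw [add_mul, add_mul]
      exact p.add_mem (hx r) (hy r)
    | neg x _ hx =>
      intro r
      rw [neg_mul, neg_mul]
      exact p.neg_mem (hx r)
    | left_absorb s x _ hx =>
      intro r
      rw [mul_assoc, mul_assoc, ← mul_assoc x]
      exact p.mul_mem_left _ _ (hx r)
    | right_absorb s x _ hx =>
      intro r
      rw [mul_assoc x]
      exact hx _
  have h2 : ∀ x ∈ TwoSidedIdeal.span {a}, ∀ y ∈ TwoSidedIdeal.span {b}, ∀ r, x * r * y ∈ p := by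
    intro x hx y hy
    induction hy using TwoSidedIdeal.span_induction with
    | mem y hy =>
      obtain rfl := hy
      exact h1 x hx
    | zero => simp [p.zero_mem]
    | add y z _ _ hy hz =>
      intro r
      rw [mul_add]
      exact p.add_mem (hy r) (hz r)
    | neg y _ hy =>
      intro r
      rw [mul_neg]
      exact p.neg_mem (hy r)
    | left_absorb s y _ hy =>
      intro r
      rw [← mul_assoc, mul_assoc x]
      exact hy _
    | right_absorb s y _ hy =>
      intro r
      rw [← mul_assoc]
      exact p.mul_mem_right _ _ (hy r)
  refine (hp.le_or_le (.span {a}) (.span {b}) fun x hx y hy => ?_).imp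
    (fun h => h (TwoSidedIdeal.subset_span rfl)) (fun h => h (TwoSidedIdeal.subset_span rfl))
  simpa using h2 x hx y hy 1

variable {K A ι : Type*} [CommRing K] [Ring A] [Algebra K A]

/-- Every `r` is a sum of products `x * y` with `x ∈ S` and `y` centralizing `S`, and `e * (x * y) *
g = y * (e * g) * x`. -/
theorem mul_mul_mem_of_commute {p : TwoSidedIdeal A} {S : Subalgebra K A}
    (hS : S ⊔ Subalgebra.centralizer K (S : Set A) = ⊤) {e g : A} (he : e ∈ S)
    (hg : g ∈ Subalgebra.centralizer K (S : Set A)) (h : e * g ∈ p) (r : A) :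
    e * r * g ∈ p := by
  have hc (x : S) (y : Subalgebra.centralizer K (S : Set A)) :
      Commute (S.val x) ((Subalgebra.centralizer K (S : Set A)).val y) :=
    (Subalgebra.mem_centralizer_iff K).1 y.2 x x.2
  obtain ⟨t, rfl⟩ : ∃ t, Algebra.TensorProduct.lift S.val
      (Subalgebra.centralizer K (S : Set A)).val hc t = r := by
    have h1 : S ⊔ Subalgebra.centralizer K (S : Set A) ≤ (Algebra.TensorProduct.lift S.val
        (Subalgebra.centralizer K (S : Set A)).val hc).range :=
      sup_le (fun x hx => ⟨⟨x, hx⟩ ⊗ₜ 1, by simp⟩) fun x hx => ⟨1 ⊗ₜ ⟨x, hx⟩, by simp⟩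
    exact h1 (hS ▸ Algebra.mem_top)
  induction t using TensorProduct.induction_on with
  | zero => simp [p.zero_mem]
  | add x y hx hy =>
    rw [map_add, mul_add, add_mul]
    exact p.add_mem hx hy
  | tmul x y =>
    have h1 : (e : A) * y = y * e := (Subalgebra.mem_centralizer_iff K).1 y.2 e he
    have h2 : (x : A) * g = g * x := (Subalgebra.mem_centralizer_iff K).1 hg x x.2
    have h3 : (x : A) * y = y * x := hc x y
    have h4 : e * (x * y) * g = y * (e * g) * x := by
      rw [h3, ← mul_assoc, h1, mul_assoc, h2]
      simp only [mul_assoc]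
    rw [Algebra.TensorProduct.lift_tmul, Subalgebra.coe_val, Subalgebra.coe_val, h4]
    exact p.mul_mem_right _ _ (p.mul_mem_left _ _ h)

theorem IsPrimeTwoSided.exists_mem_of_list_prod_mem {p : TwoSidedIdeal A}
    (hp : IsPrimeTwoSided p) {S : ι → Subalgebra K A}
    (hcomm : ∀ i j, i ≠ j → S i ≤ Subalgebra.centralizer K (S j : Set A))
    (htop : ⨆ i, S i = ⊤) {e : ι → A} (he : ∀ i, e i ∈ S i) (l : List ι) (hl : l.Nodup)
    (h : (l.map e).prod ∈ p) : ∃ i, e i ∈ p := by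
  induction l with
  | nil => exact (hp.ne_top ((TwoSidedIdeal.one_mem_iff p).1 (by simpa using h))).elim
  | cons k l ih =>
    rw [List.nodup_cons] at hl
    rw [List.map_cons, List.prod_cons] at h
    refine (hp.mem_or_mem (mul_mul_mem_of_commute (S := S k) ?_ (he k) ?_ h)).elim
      (fun h => ⟨k, h⟩) (ih hl.2)
    · rw [eq_top_iff, ← htop]
      refine iSup_le fun j => ?_
      by_cases hj : j = k
      · exact hj ▸ le_sup_left
      · exact (hcomm j k hj).trans le_sup_right
    · refine Subalgebra.list_prod_mem _ fun x hx => ?_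
      obtain ⟨j, hj, rfl⟩ := List.mem_map.1 hx
      exact hcomm j k (fun h => hl.1 (h ▸ hj)) (he j)

end PrimeIdeals

/-! ### Relations in `𝕀_n`, its nonzero ideals, and the contradiction -/

section Generators

variable (K : Type*) [Field K] {n : ℕ}

/-- Multiplication by `x_i` as an element of `𝕀_n`. -/
noncomputable def mulX (i : Fin n) : integroDiffAlgebra K n :=
  ⟨LinearMap.mulLeft K (X i), Algebra.subset_adjoin (.inl (.inl ⟨i, rfl⟩))⟩

/-- `∂/∂x_i` as an element of `𝕀_n`. -/
noncomputable def deriv (i : Fin n) : integroDiffAlgebra K n :=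
  ⟨_, Algebra.subset_adjoin (.inl (.inr ⟨i, rfl⟩))⟩

/-- `∫_i` as an element of `𝕀_n`. -/
noncomputable def integ (i : Fin n) : integroDiffAlgebra K n :=
  ⟨integral K n i, Algebra.subset_adjoin (.inr ⟨i, rfl⟩)⟩

/-- The idempotent `1 - ∫_i ∂/∂x_i`, evaluation at `x_i = 0`. -/
noncomputable def evalZero (i : Fin n) : integroDiffAlgebra K n := 1 - integ K i * deriv K i

/-- The subalgebra of operators in the variable `x_i`. -/
noncomputable def coordSubalgebra (i : Fin n) : Subalgebra K (integroDiffAlgebra K n) :=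
  Algebra.adjoin K {mulX K i, deriv K i, integ K i}

theorem iSup_coordSubalgebra : ⨆ i : Fin n, coordSubalgebra K i = ⊤ := by
  refine eq_top_iff.2 (Algebra.adjoin_adjoin_coe_preimage.ge.trans (Algebra.adjoin_le ?_))
  rintro ⟨a, ha⟩ ((⟨i, h⟩ | ⟨i, h⟩) | ⟨i, h⟩) <;>
    refine (le_iSup (coordSubalgebra K) i) (Algebra.subset_adjoin ?_)
  · exact Or.inl (Subtype.ext h.symm)
  · exact Or.inr (Or.inl (Subtype.ext h.symm))
  · exact Or.inr (Or.inr (Subtype.ext h.symm))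

theorem evalZero_mem (i : Fin n) : evalZero K i ∈ coordSubalgebra K i := by
  have h1 : integ K i ∈ coordSubalgebra K i := Algebra.subset_adjoin (by simp)
  have h2 : deriv K i ∈ coordSubalgebra K i := Algebra.subset_adjoin (by simp)
  have h3 : evalZero K i = 1 + (-1 : K) • (integ K i * deriv K i) := by
    refine Subtype.ext ?_
    change (1 : Module.End K _) - _ = 1 + (-1 : K) • _
    rw [neg_one_smul, ← sub_eq_add_neg]
  rw [h3]
  exact (coordSubalgebra K i).add_mem (Subalgebra.one_mem _)
    ((coordSubalgebra K i).smul_mem ((coordSubalgebra K i).mul_mem h1 h2) _)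

variable [CharZero K]

theorem mulX_dpow (i : Fin n) (α : Fin n → ℤ) :
    (mulX K i).1 (dpow K α) = ((α i : K) + 1) • dpow K (α + Pi.single i 1) := X_mul_dpow K i α

theorem deriv_dpow (i : Fin n) (α : Fin n → ℤ) :
    (deriv K i).1 (dpow K α) = dpow K (α + Pi.single i (-1)) := pderiv_dpow K i α

theorem integ_dpow (i : Fin n) (α : Fin n → ℤ) :
    (integ K i).1 (dpow K α) = (if α i = -1 then 0 else 1 : K) • dpow K (α + Pi.single i 1) :=
  integral_dpow K i α

theorem ext_dpow {a b : integroDiffAlgebra K n}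
    (h : ∀ α, 0 ≤ α → a.1 (dpow K α) = b.1 (dpow K α)) : a = b :=
  Subtype.ext (linearMap_ext_dpow K h)

theorem commute_of_apply_dpow {i j : Fin n} (hij : i ≠ j) {a b : integroDiffAlgebra K n}
    {c d : ℤ → K} {k l : ℤ} (ha : ∀ α, a.1 (dpow K α) = c (α i) • dpow K (α + Pi.single i k))
    (hb : ∀ α, b.1 (dpow K α) = d (α j) • dpow K (α + Pi.single j l)) : a * b = b * a := by
  refine ext_dpow K fun α _ => ?_
  simp only [MulMemClass.coe_mul, Module.End.mul_apply, ha, hb, map_smul, Pi.add_apply,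
    Pi.single_eq_of_ne hij, Pi.single_eq_of_ne hij.symm, add_zero]
  rw [smul_comm, add_right_comm]

theorem exists_of_mem_generators {i : Fin n} {a : integroDiffAlgebra K n}
    (ha : a ∈ ({mulX K i, deriv K i, integ K i} : Set (integroDiffAlgebra K n))) :
    ∃ (c : ℤ → K) (k : ℤ), ∀ α, a.1 (dpow K α) = c (α i) • dpow K (α + Pi.single i k) := by
  obtain rfl | rfl | rfl := ha
  · exact ⟨fun t => t + 1, 1, mulX_dpow K i⟩
  · exact ⟨fun _ => 1, -1, fun α => by rw [one_smul, deriv_dpow]⟩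
  · exact ⟨fun t => if t = -1 then 0 else 1, 1, integ_dpow K i⟩

/-- Passing to the double centralizer reduces the claim to generators, which act on divided powers
through different coordinates. -/
theorem coordSubalgebra_le_centralizer {i j : Fin n} (hij : i ≠ j) :
    coordSubalgebra K i ≤
      Subalgebra.centralizer K (coordSubalgebra K j : Set (integroDiffAlgebra K n)) := by
  refine Algebra.adjoin_le fun a ha => (Subalgebra.mem_centralizer_iff K).2 fun b hb => ?_
  refine ((Subalgebra.mem_centralizer_iff K).1
    (Algebra.adjoin_le_centralizer_centralizer K _ hb) a ?_).symm
  refine (Subalgebra.mem_centralizer_iff K).2 fun b hb => ?_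
  obtain ⟨c, k, ha⟩ := exists_of_mem_generators K ha
  obtain ⟨d, l, hb⟩ := exists_of_mem_generators K hb
  exact commute_of_apply_dpow K hij.symm hb ha

theorem deriv_mul_integ (i : Fin n) : deriv K i * integ K i = 1 := by
  refine ext_dpow K fun α hα => ?_
  have h : α i ≠ -1 := by
    have := hα i
    simp only [Pi.zero_apply] at this
    lia
  simp [integ_dpow, deriv_dpow, h, add_assoc, ← Pi.single_add]

theorem deriv_mul_mulX (i : Fin n) :
    deriv K i * mulX K i = mulX K i * deriv K i + 1 := by
  refine ext_dpow K fun α hα => ?_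
  simp [mulX_dpow, deriv_dpow, add_assoc, ← Pi.single_add, add_smul]

theorem evalZero_dpow (i : Fin n) (α : Fin n → ℤ) :
    (evalZero K i).1 (dpow K α) = if α i = 0 then dpow K α else 0 := by
  simp only [evalZero, AddSubgroupClass.coe_sub, OneMemClass.coe_one, MulMemClass.coe_mul,
    LinearMap.sub_apply, Module.End.one_apply, Module.End.mul_apply, integ_dpow, deriv_dpow,
    Pi.add_apply, Pi.single_eq_same, add_assoc, ← Pi.single_add]
  by_cases h : α i = 0 <;> simp [h]

theorem list_prod_evalZero_dpow (l : List (Fin n)) (α : Fin n → ℤ) :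
    (l.map (evalZero K)).prod.1 (dpow K α) = if ∀ i ∈ l, α i = 0 then dpow K α else 0 := by
  induction l with
  | nil => simp
  | cons k l ih =>
    rw [List.map_cons, List.prod_cons, MulMemClass.coe_mul, Module.End.mul_apply, ih]
    by_cases h : ∀ i ∈ l, α i = 0
    · rw [if_pos h, evalZero_dpow]
      simp only [List.forall_mem_cons, and_iff_left h]
    · rw [if_neg h, map_zero, if_neg fun h' => h fun i hi => h' i (List.mem_cons_of_mem _ hi)]

theorem prod_evalZero_dpow (α : Fin n → ℤ) :
    ((List.finRange n).map (evalZero K)).prod.1 (dpow K α) = if α = 0 then dpow K α else 0 := by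
  rw [list_prod_evalZero_dpow]
  simp [funext_iff]

theorem prod_evalZero_apply (f : MvPolynomial (Fin n) K) :
    ((List.finRange n).map (evalZero K)).prod.1 f = dcoeff K 0 f • dpow K 0 := by
  refine LinearMap.congr_fun (g := (dcoeff K 0).smulRight (dpow K 0)) (linearMap_ext_dpow K ?_) f
  intro α hα
  rw [prod_evalZero_dpow, LinearMap.smulRight_apply]
  split_ifs with h
  · rw [h, dcoeff_dpow_self K le_rfl, one_smul]
  · rw [dcoeff_dpow_of_ne K (Ne.symm h), zero_smul]

theorem dcoeff_deriv (i : Fin n) {γ : Fin n → ℤ} (hγ : 0 ≤ γ) (f : MvPolynomial (Fin n) K) :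
    dcoeff K γ ((deriv K i).1 f) = dcoeff K (γ + Pi.single i 1) f := by
  refine LinearMap.congr_fun (f := dcoeff K γ ∘ₗ (deriv K i).1) (linearMap_ext_dpow K ?_) f
  intro α hα
  rw [LinearMap.comp_apply, deriv_dpow]
  by_cases h : γ + Pi.single i 1 = α
  · rw [← h, add_assoc, ← Pi.single_add, add_neg_cancel, Pi.single_zero, add_zero,
      dcoeff_dpow_self K hγ, dcoeff_dpow_self K (h ▸ hα)]
  · rw [dcoeff_dpow_of_ne K h, dcoeff_dpow_of_ne K]
    rintro rfl
    exact h (by rw [add_assoc, ← Pi.single_add, neg_add_cancel, Pi.single_zero, add_zero])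

/-- At `α = 0`, `U` creates the divided power of `ν` from `1`, and `D` moves its coefficient to the
constant term. They are built from integrations and derivatives respectively. -/
theorem exists_raise_lower (ν : Fin n →₀ ℕ) :
    ∃ U D : integroDiffAlgebra K n, ∀ α, 0 ≤ α →
      U.1 (dpow K α) = dpow K (α + fun i => (ν i : ℤ)) ∧
      ∀ f, dcoeff K α (D.1 f) = dcoeff K (α + fun i => (ν i : ℤ)) f := by
  induction ν using Finsupp.induction_linear with
  | zero => exact ⟨1, 1, fun α _ => by simp [← Pi.zero_def]⟩
  | add ν μ hν hμ =>
    obtain ⟨U, D, h⟩ := hν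
    obtain ⟨U', D', h'⟩ := hμ
    refine ⟨U' * U, D * D', fun α hα => ?_⟩
    have hα' : 0 ≤ α + fun i => (ν i : ℤ) := add_nonneg hα fun i => by simp
    have h1 : (fun i => ((ν + μ) i : ℤ)) = (fun i => (ν i : ℤ)) + fun i => (μ i : ℤ) := by
      ext i
      simp
    rw [h1, ← add_assoc]
    refine ⟨?_, fun f => ?_⟩
    · rw [MulMemClass.coe_mul, Module.End.mul_apply, (h α hα).1, (h' _ hα').1]
    · rw [MulMemClass.coe_mul, Module.End.mul_apply, (h α hα).2, (h' _ hα').2]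
  | single i k =>
    induction k with
    | zero => exact ⟨1, 1, fun α _ => by simp [← Pi.zero_def]⟩
    | succ k ih =>
      obtain ⟨U, D, h⟩ := ih
      refine ⟨integ K i * U, D * deriv K i, fun α hα => ?_⟩
      have hα' : 0 ≤ α + fun j => (Finsupp.single i k j : ℤ) := add_nonneg hα fun i => by simp
      have h1 : (fun j => (Finsupp.single i (k + 1) j : ℤ)) =
          (fun j => (Finsupp.single i k j : ℤ)) + Pi.single i 1 := by
        ext j
        by_cases hj : j = i
        · subst hj
          simp
        · simp [hj, Finsupp.single_apply, Ne.symm hj]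
      rw [h1, ← add_assoc, MulMemClass.coe_mul, Module.End.mul_apply, (h α hα).1, integ_dpow, if_neg,
        one_smul]
      · exact ⟨rfl, fun f => by
          rw [MulMemClass.coe_mul, Module.End.mul_apply, (h α hα).2, dcoeff_deriv K i hα']⟩
      · have := hα' i
        rw [Pi.zero_apply] at this
        lia

/-- Some matrix entry of a nonzero `a ∈ p` is nonzero. Moving it to the corner gives `E * D * a * U
* E`, which is that entry times `E`, because `E` is the rank-one projection onto constants. -/
theorem prod_evalZero_mem {p : TwoSidedIdeal (integroDiffAlgebra K n)} (hp : p ≠ ⊥) :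
    ((List.finRange n).map (evalZero K)).prod ∈ p := by
  obtain ⟨a, ha, ha0⟩ : ∃ a ∈ p, a ≠ 0 := by
    by_contra! h
    exact hp (le_bot_iff.1 fun x hx => (TwoSidedIdeal.mem_bot _).2 (h x hx))
  obtain ⟨α, hα, h⟩ : ∃ α, 0 ≤ α ∧ a.1 (dpow K α) ≠ 0 := by
    by_contra! h
    exact ha0 (ext_dpow K fun α hα => by rw [h α hα]; simp)
  obtain ⟨γ, h⟩ : ∃ γ, dcoeff K γ (a.1 (dpow K α)) ≠ 0 := by
    by_contra! h'
    exact h (dcoeff_ext K fun γ => by rw [h' γ, map_zero])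
  have hγ : 0 ≤ γ := by
    by_contra h'
    exact h (by rw [dcoeff_of_not_nonneg K h', LinearMap.zero_apply])
  have cast_expo {β : Fin n → ℤ} (hβ : 0 ≤ β) : (0 + fun i => (expo β i : ℤ)) = β := by
    rw [zero_add]
    ext i
    exact Int.toNat_of_nonneg (hβ i)
  obtain ⟨U, _, hU⟩ := exists_raise_lower K (expo α)
  obtain ⟨_, D, hD⟩ := exists_raise_lower K (expo γ)
  have hU0 := (hU 0 le_rfl).1
  have hD0 := (hD 0 le_rfl).2
  rw [cast_expo hα] at hU0
  rw [cast_expo hγ] at hD0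
  set E := ((List.finRange n).map (evalZero K)).prod with hE
  have key : E = (dcoeff K γ (a.1 (dpow K α)))⁻¹ • (E * D * a * (U * E)) := by
    refine ext_dpow K fun β _ => ?_
    simp only [SetLike.val_smul, MulMemClass.coe_mul, LinearMap.smul_apply, Module.End.mul_apply]
    rw [prod_evalZero_dpow]
    split_ifs with hβ
    · rw [hβ, hU0, prod_evalZero_apply, hD0, smul_smul, inv_mul_cancel₀ h, one_smul]
    · simp only [map_zero, smul_zero]
  rw [key, Algebra.smul_def]
  exact p.mul_mem_left _ _ (p.mul_mem_right _ _ (p.mul_mem_left _ _ ha))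

theorem IsPrimeTwoSided.exists_evalZero_mem {p : TwoSidedIdeal (integroDiffAlgebra K n)}
    (hp : IsPrimeTwoSided p) (hp0 : p ≠ ⊥) : ∃ i, evalZero K i ∈ p :=
  hp.exists_mem_of_list_prod_mem (fun _ _ => coordSubalgebra_le_centralizer K)
    (iSup_coordSubalgebra K) (evalZero_mem K) _ (List.nodup_finRange n) (prod_evalZero_mem K hp0)

theorem map_evalZero_ne_zero (f : integroDiffAlgebra K n →+* integroDiffAlgebra K n)
    (i : Fin n) : f (evalZero K i) ≠ 0 := by
  intro hf
  have h0 : evalZero K i + integ K i * deriv K i = 1 :=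
    Subtype.ext (sub_add_cancel _ _)
  have h := congrArg f h0
  rw [map_add, hf, zero_add, map_mul, map_one] at h
  have h1 : f (deriv K i) * f (integ K i) = 1 := by rw [← map_mul, deriv_mul_integ, map_one]
  -- With `h = ∂x`, the relation `∂x = x∂ + 1` gives `∂h = ∂(x∂ + 1) = h∂ + ∂`.
  have h2 : f (deriv K i) * f (deriv K i * mulX K i) =
      f (deriv K i * mulX K i) * f (deriv K i) + f (deriv K i) := by
    rw [← map_mul, ← map_mul, ← map_add]
    congr 1
    conv_lhs => rw [deriv_mul_mulX]
    rw [mul_add, mul_one, mul_assoc]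
  exact (isRegular_of_mem (f (deriv K i)).2).not_conj_eq_add_one
    (isRegular_of_mem (f (integ K i)).2) (isRegular_of_mem (f (deriv K i * mulX K i)).2)
    (congrArg Subtype.val h1) (congrArg Subtype.val h) (congrArg Subtype.val h2)

end Generators

end IntDiff

theorem mainTheorem12 (K : Type*) [Field K] [CharZero K] (n : ℕ)
    (p : TwoSidedIdeal (IntDiff.integroDiffAlgebra K n))
    (hp : IntDiff.IsPrimeTwoSided p) (hp0 : p ≠ ⊥) :
    ¬ ∃ f : p.ringCon.Quotient →ₐ[K] IntDiff.integroDiffAlgebra K n,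
      Function.Injective f := by
  rintro ⟨f, -⟩
  obtain ⟨i, hi⟩ := hp.exists_evalZero_mem K hp0
  refine IntDiff.map_evalZero_ne_zero K ((f : _ →+* _).comp p.ringCon.mk') i ?_
  have h : p.ringCon.mk' (IntDiff.evalZero K i) = 0 :=
    (RingCon.eq _).2 ((TwoSidedIdeal.mem_iff p _).1 hi)
  rw [RingHom.comp_apply, h, map_zero]
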